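/- Let $n\ge 2$ and let $\mathcal M\subset\mathbb R^n$ be a discrete $n$-manifold, i.e. a finite simplicial $n$-complex (every simplex is a face of an $n$-simplex) whose underlying space is homeomorphic to the closed unit ball $\mathbb B^n$. Write $\mathbb S_k(\mathcal M)$ for its set of $k$-simplices. Let $\rho$ be a positive density that is constant on each $n$-simplex, and put $\mu(\sigma)=\rho(\sigma)\,|\sigma|$ for $\sigma\in\mathbb S_n(\mathcal M)$, where $|\cdot|$ denotes Euclidean volume of the appropriate dimension. A vertex $v$ is *interior* if its link (the union of the $(n-1)$-simplices $\tau\not\ni v$ such that $[v,\tau]\in\mathbb S_n(\mathcal M)$) is homeomorphic to $\mathbb S^{n-1}$, and is a *boundary vertex* otherwise. A piecewise affine map $f:\mathcal M\to\mathbb R^n$ (affine on each $n$-simplex) is *orientation preserving* if its Jacobian determinant is positive on every $n$-simplex. Let $v_1,\dots,v_N$ be the vertices of $\mathcal M$, $\mathbf f_i=f(v_i)$, and let $\mathbf f\in\mathbb R^{N\times n}$ be the matrix with rows $\mathbf f_i$. The discrete volumetric stretch energy is $$E_V(f)=\tfrac1n\,\mathrm{trace}\big(\mathbf f^\top L_V(f)\,\mathbf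 f\big),$$ where $L_V(f)$ is the Laplacian matrix with off-diagonal entries $-w_{ij}(f)$ if $[v_i,v_j]\in\mathbb S_1(\mathcal M)$ and $0$ otherwise, diagonal entries $\sum_{\ell\ne i}w_{i\ell}(f)$, and weights $$w_{ij}(f)=\frac1{n(n-1)}\sum_{\sigma\in\mathbb S_n(\mathcal M):\,v_i,v_j\in\sigma}\frac{|f(\sigma_{\hat i\hat j})|}{\mu(\sigma)/|f(\sigma)|}\,\cot\theta_{ij}^\sigma(f).$$ Here $\sigma_{\hat i\hat j}$ is the $(n-2)$-face of $\sigma$ spanned by its vertices other than $v_i,v_j$, and $\theta^\sigma_{ij}(f)\in(0,\pi)$ is the dihedral angle of the simplex $f(\sigma)$ between its facets opposite to $\mathbf f_i$ and $\mathbf f_j$. For $C\in\mathbb R$ call $f$ *admissible* if it is an orientation preserving piecewise affine map $\mathcal M\to\mathbb B^n$ with $\sum_{\sigma\in\mathbb S_n(\mathcal M)}|f(\sigma)|=C$ that sends every boundary vertex of $\mathcal M$ to $\mathbb S^{n-1}$, and let $S_f=\{E_V(f)\mid f\text{ admissible}\}$. Then: (i) every element of $S_f$ is at least $\dfrac{C^2}{\sum_{\sigma\in\mathbb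 S_n(\mathcal M)}\mu(\sigma)}$; (ii) for every admissible $f^*$, the equality $E_V(f^*)=\dfrac{C^2}{\sum_{\sigma\in\mathbb S_n(\mathcal M)}\mu(\sigma)}$ holds if and only if $f^*$ is mass-preserving, i.e. $$\frac{|f^*(\sigma)|}{\sum_{\tau\in\mathbb S_n(\mathcal M)}|f^*(\tau)|}=\frac{\mu(\sigma)}{\sum_{\tau\in\mathbb S_n(\mathcal M)}\mu(\tau)}\quad\text{for every }\sigma\in\mathbb S_n(\mathcal M).$$ Equivalently, $f^*$ is mass-preserving if and only if $E_V(f^*)$ is the minimum of $S_f$ and this minimum equals the bound. -/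

import Mathlib

open MeasureTheory

/-- The Euclidean space `ℝⁿ`. -/
abbrev Euc (n : ℕ) : Type := EuclideanSpace ℝ (Fin n)

/-- The `k`-dimensional Euclidean volume `|S|` of a subset `S` of `ℝⁿ`: the `k`-dimensional
Hausdorff measure, normalised so as to agree with Lebesgue measure on `k`-dimensional subspaces
(for `k = n` it is Lebesgue measure on `ℝⁿ`, for `k = 0` it is the counting measure). -/
noncomputable def kVolume {n : ℕ} (k : ℕ) (S : Set (Euc n)) : ℝ :=
  (μHE[k] : Measure (Euc n)).real S

/-- A discrete `n`-manifold: a finite simplicial `n`-complex in `ℝⁿ` (every simplex is a face of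
an `n`-simplex) whose underlying space is homeomorphic to the closed unit ball of `ℝⁿ`. -/
structure DiscreteManifold (n : ℕ) where
  /-- the underlying geometric simplicial complex; a simplex is recorded by its vertex set -/
  complex : Geometry.SimplicialComplex ℝ (Euc n)
  finite_faces : complex.faces.Finite
  pure : ∀ s ∈ complex.faces, ∃ t ∈ complex.faces, s ⊆ t ∧ t.card = n + 1
  ball : Nonempty (complex.space ≃ₜ Metric.closedBall (0 : Euc n) 1)

namespace DiscreteManifold

variable {n : ℕ}

/-- The set of `k`-simplices of the complex, each recorded by its `k + 1` vertices. -/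
noncomputable def simplices (M : DiscreteManifold n) (k : ℕ) : Finset (Finset (Euc n)) :=
  M.finite_faces.toFinset.filter fun s => s.card = k + 1

open Classical in
/-- The set of vertices of the complex. -/
noncomputable def vertices (M : DiscreteManifold n) : Finset (Euc n) :=
  M.finite_faces.toFinset.biUnion id

theorem mem_vertices (M : DiscreteManifold n) (v : Euc n) :
    v ∈ M.vertices ↔ v ∈ M.complex.vertices := by
  simp only [vertices, Finset.mem_biUnion, Set.Finite.mem_toFinset, id]
  constructor
  · rintro ⟨s, hs, hv⟩
    exact M.complex.down_closed hs (Finset.singleton_subset_iff.2 hv) (Finset.singleton_nonempty v)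
  · intro hv
    exact ⟨{v}, hv, Finset.mem_singleton_self v⟩

open Classical in
/-- The link of `v`: the union of the `(n - 1)`-simplices `τ` not containing `v` such that
`[v, τ]` is an `n`-simplex of the complex. (A set with `n` elements is an `(n - 1)`-simplex.) -/
def link (M : DiscreteManifold n) (v : Euc n) : Set (Euc n) :=
  ⋃ τ ∈ {τ : Finset (Euc n) |
      τ ∈ M.complex.faces ∧ τ.card = n ∧ v ∉ τ ∧ insert v τ ∈ M.simplices n},
    convexHull ℝ (τ : Set (Euc n))

/-- A vertex is interior if its link is homeomorphic to the sphere `𝕊ⁿ⁻¹`, the unit sphere of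
`ℝⁿ`. -/
def IsInteriorVertex (M : DiscreteManifold n) (v : Euc n) : Prop :=
  v ∈ M.vertices ∧ Nonempty (M.link v ≃ₜ Metric.sphere (0 : Euc n) 1)

/-- A vertex is a boundary vertex if it is not interior. -/
def IsBoundaryVertex (M : DiscreteManifold n) (v : Euc n) : Prop :=
  v ∈ M.vertices ∧ ¬ M.IsInteriorVertex v

/-! ### Piecewise affine maps

A map on the underlying space is given by a function on `ℝⁿ`; its values off the underlying space
play no role. -/

/-- `f` restricts to an affine map on every `n`-simplex. -/
def PiecewiseAffine (M : DiscreteManifold n) (f : Euc n → Euc n) : Prop :=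
  ∀ σ ∈ M.simplices n, ∃ A : Euc n →ᵃ[ℝ] Euc n,
    Set.EqOn f A (convexHull ℝ (σ : Set (Euc n)))

/-- On every `n`-simplex, `f` is affine with positive Jacobian determinant. -/
def OrientationPreserving (M : DiscreteManifold n) (f : Euc n → Euc n) : Prop :=
  ∀ σ ∈ M.simplices n, ∃ A : Euc n →ᵃ[ℝ] Euc n,
    Set.EqOn f A (convexHull ℝ (σ : Set (Euc n))) ∧ 0 < LinearMap.det A.linear

/-- The volume `|f(τ)|` of the image of the `k`-simplex with vertex set `τ`. -/
noncomputable def imageVolume (k : ℕ) (f : Euc n → Euc n) (τ : Finset (Euc n)) : ℝ :=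
  kVolume k (f '' convexHull ℝ (τ : Set (Euc n)))

/-- The mass `μ(σ) = ρ(σ) |σ|` of an `n`-simplex, for a density `ρ` that is constant on each
`n`-simplex. -/
noncomputable def mass (ρ : Finset (Euc n) → ℝ) (σ : Finset (Euc n)) : ℝ :=
  ρ σ * kVolume n (convexHull ℝ (σ : Set (Euc n)))

/-! ### The volumetric stretch energy -/

/-- The stretch factor `μ(σ) / |f(σ)|`. -/
noncomputable def stretchFactor (ρ : Finset (Euc n) → ℝ) (f : Euc n → Euc n)
    (σ : Finset (Euc n)) : ℝ :=
  mass ρ σ / imageVolume n f σ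

/-- For distinct vertices `v`, `w` of `σ`, the component of `f v - f w` orthogonal to the facet of
`f(σ)` opposite to `f v`; it is normal to that facet and points towards `f v`, that is, to the
inside of `f(σ)`. -/
noncomputable def inwardNormal (f : Euc n → Euc n) (σ : Finset (Euc n)) (v w : Euc n) : Euc n :=
  (vectorSpan ℝ (f '' ((σ : Set (Euc n)) \ {v})))ᗮ.starProjection (f v - f w)

/-- The dihedral angle of the simplex `f(σ)` between its facets opposite to `f v` and to `f w`:
the supplement of the angle between the inward normals of these facets. -/
noncomputable def dihedralAngle (f : Euc n → Euc n) (σ : Finset (Euc n)) (v w : Euc n) : ℝ :=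
  Real.pi - InnerProductGeometry.angle (inwardNormal f σ v w) (inwardNormal f σ w v)

open Classical in
/-- The modified cotangent weight of the pair `v`, `w`: the sum over all `n`-simplices `σ`
containing both of `|f(σ \ {v, w})| / (stretch factor of σ) * cot θ`, divided by `n (n - 1)`. -/
noncomputable def weight (M : DiscreteManifold n) (ρ : Finset (Euc n) → ℝ) (f : Euc n → Euc n)
    (v w : Euc n) : ℝ :=
  1 / ((n : ℝ) * ((n : ℝ) - 1)) *
    ∑ σ ∈ (M.simplices n).filter (fun σ => v ∈ σ ∧ w ∈ σ),
      imageVolume (n - 2) f (σ \ {v, w}) / stretchFactor ρ f σ *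
        Real.cot (dihedralAngle f σ v w)

open Classical in
/-- The volumetric stretch Laplacian matrix `L_V(f)`, indexed by the vertices. -/
noncomputable def stretchLaplacian (M : DiscreteManifold n) (ρ : Finset (Euc n) → ℝ)
    (f : Euc n → Euc n) : Matrix M.vertices M.vertices ℝ :=
  Matrix.of fun i j =>
    if i = j then ∑ l ∈ Finset.univ.erase i, M.weight ρ f i l
    else if ({(i : Euc n), (j : Euc n)} : Finset (Euc n)) ∈ M.simplices 1 then
      - M.weight ρ f i j
    else 0

/-- The matrix whose row at the vertex `v` is `f v`. -/
def coordMatrix (M : DiscreteManifold n) (f : Euc n → Euc n) : Matrix M.vertices (Fin n) ℝ :=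
  Matrix.of fun v s => f v s

/-- The discrete volumetric stretch energy `E_V(f) = (1/n) trace (𝐟ᵀ L_V(f) 𝐟)`. -/
noncomputable def stretchEnergy (M : DiscreteManifold n) (ρ : Finset (Euc n) → ℝ)
    (f : Euc n → Euc n) : ℝ :=
  1 / (n : ℝ) *
    ((M.coordMatrix f).transpose * M.stretchLaplacian ρ f * M.coordMatrix f).trace

/-- The admissible maps: orientation preserving piecewise affine maps from the underlying space to
the unit ball, of total image volume `C`, that send the boundary vertices to the unit sphere. -/
structure Admissible (M : DiscreteManifold n) (C : ℝ) (f : Euc n → Euc n) : Prop where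
  piecewiseAffine : M.PiecewiseAffine f
  orientationPreserving : M.OrientationPreserving f
  mapsTo : Set.MapsTo f M.complex.space (Metric.closedBall 0 1)
  boundary : ∀ v, M.IsBoundaryVertex v → f v ∈ Metric.sphere (0 : Euc n) 1
  volume_eq : ∑ σ ∈ M.simplices n, imageVolume n f σ = C

/-- The set `S_f` of the energies of all admissible maps. -/
def energySet (M : DiscreteManifold n) (ρ : Finset (Euc n) → ℝ) (C : ℝ) : Set ℝ :=
  {e | ∃ f : Euc n → Euc n, M.Admissible C f ∧ M.stretchEnergy ρ f = e}

/-- `f` is mass-preserving: every `n`-simplex has the same share of the total image volume as of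
the total mass. -/
def MassPreserving (M : DiscreteManifold n) (ρ : Finset (Euc n) → ℝ) (f : Euc n → Euc n) : Prop :=
  ∀ σ ∈ M.simplices n,
    imageVolume n f σ / ∑ τ ∈ M.simplices n, imageVolume n f τ =
      mass ρ σ / ∑ τ ∈ M.simplices n, mass ρ τ

end DiscreteManifold

/-! The energy collapses to `E_V(f) = ∑ |f(σ)|² / μ(σ)` (`stretchEnergy_eq_sum`). The bound is then
Cauchy–Schwarz in quotient form, with equality exactly when `|f(σ)| / μ(σ)` is the same for all `σ`,
which is mass preservation.

The collapse is local. Let `b i` be the vertices of `f(σ)` and `g i` the gradients of its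
barycentric coordinates. The gradient `g i` is normal to the facet opposite to `b i`, so the
dihedral cotangent is `-⟪g i, g j⟫ / √D`, where `D` is the Gram determinant of `g i, g j`. Jacobi's
complementary minor identity, applied to the Gram matrix of the edge vectors, gives `n (n - 1)
|f(σ)| √D` as the volume of the face opposite to the edge. The roots cancel: face volume times
cotangent is `-n (n - 1) |f(σ)| ⟪g i, g j⟫` (`kVolume_mul_cot`).

Finally `-∑ ⟪g i, g j⟫ ‖b i - b j‖² = 2 n`, since `∑ b i ⊗ g i` is the identity and the `g i` sum to
zero. So each simplex contributes `|f(σ)|` times the inverse stretch factor `|f(σ)| / μ(σ)`. -/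

/-! ### Volumes of simplices as Gram determinants. -/

theorem volume_cornerSimplex (k : ℕ) {r : ℝ} (hr : 0 ≤ r) :
    volume {x : Fin k → ℝ | (∀ i, 0 ≤ x i) ∧ ∑ i, x i ≤ r} =
      ENNReal.ofReal (r ^ k / k.factorial) := by
  induction k generalizing r with
  | zero => simp [hr, Measure.volume_pi_eq_dirac (0 : Fin 0 → ℝ)]
  | succ k ih =>
    have hpre : {x : Fin (k + 1) → ℝ | (∀ i, 0 ≤ x i) ∧ ∑ i, x i ≤ r} =
        MeasurableEquiv.piFinSuccAbove (fun _ => ℝ) 0 ⁻¹'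
          {z : ℝ × (Fin k → ℝ) | 0 ≤ z.1 ∧ (∀ i, 0 ≤ z.2 i) ∧ ∑ i, z.2 i ≤ r - z.1} := by
      ext x
      simp only [Set.mem_ofPred_eq, Set.mem_preimage, MeasurableEquiv.piFinSuccAbove_apply,
        Fin.forall_fin_succ, Fin.sum_univ_succ, Fin.insertNthEquiv_zero, Fin.consEquiv_symm_apply,
        Fin.tail, le_sub_iff_add_le', and_assoc]
    have hmeas : MeasurableSet
        {z : ℝ × (Fin k → ℝ) | 0 ≤ z.1 ∧ (∀ i, 0 ≤ z.2 i) ∧ ∑ i, z.2 i ≤ r - z.1} := by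
      apply IsClosed.measurableSet
      simp only [Set.ofPred_and, Set.ofPred_forall]
      refine (isClosed_le (by fun_prop) (by fun_prop)).inter
        ((isClosed_iInter fun i => isClosed_le (by fun_prop) (by fun_prop)).inter
          (isClosed_le (by fun_prop) (by fun_prop)))
    -- Fixing the first coordinate at `t` leaves a corner simplex of size `r - t`, or nothing when
    -- `t` lies outside `[0, r]`.
    have hslice : ∀ t : ℝ, volume (Prod.mk t ⁻¹'
        {z : ℝ × (Fin k → ℝ) | 0 ≤ z.1 ∧ (∀ i, 0 ≤ z.2 i) ∧ ∑ i, z.2 i ≤ r - z.1}) =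
        (Set.Icc 0 r).indicator (fun t => ENNReal.ofReal ((r - t) ^ k / k.factorial)) t := by
      intro t
      by_cases ht : t ∈ Set.Icc 0 r
      · rw [Set.indicator_of_mem ht, ← ih (sub_nonneg.2 ht.2)]
        simp [ht.1]
      · rw [Set.indicator_of_notMem ht]
        convert measure_empty (μ := (volume : Measure (Fin k → ℝ)))
        ext y
        simp only [Set.mem_preimage, Set.mem_ofPred_eq, Set.mem_empty_iff_false, iff_false]
        rintro ⟨h0, h1, h2⟩
        have := Finset.sum_nonneg fun i (_ : i ∈ Finset.univ) => h1 i
        exact ht ⟨h0, by linarith⟩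
    rw [hpre, (volume_preserving_piFinSuccAbove (fun _ => ℝ) 0).measure_preimage
      hmeas.nullMeasurableSet, Measure.volume_eq_prod, Measure.prod_apply hmeas]
    simp_rw [hslice]
    rw [lintegral_indicator measurableSet_Icc, ← ofReal_integral_eq_lintegral_ofReal]
    · rw [integral_Icc_eq_integral_Ioc, ← intervalIntegral.integral_of_le hr,
        intervalIntegral.integral_div,
        intervalIntegral.integral_comp_sub_left (fun t => t ^ k) r, integral_pow]
      congr 1
      rw [Nat.factorial_succ]
      push_cast
      field_simp
      simp
    · exact (ContinuousOn.integrableOn_Icc (by fun_prop))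
    · filter_upwards [ae_restrict_mem measurableSet_Icc] with t ht
      have := sub_nonneg.2 ht.2
      positivity

theorem convexHull_insert_zero_basisFun (k : ℕ) :
    convexHull ℝ (insert 0 (Set.range (EuclideanSpace.basisFun (Fin k) ℝ))) =
      WithLp.ofLp ⁻¹' {x : Fin k → ℝ | (∀ i, 0 ≤ x i) ∧ ∑ i, x i ≤ 1} := by
  apply Set.Subset.antisymm
  · apply convexHull_min
    · rintro _ (rfl | ⟨j, rfl⟩)
      · simp
      · refine ⟨fun i => ?_, ?_⟩
        · by_cases h : i = j <;> simp [h]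
        · simp
    · intro x hx y hy a b ha hb hab
      refine ⟨fun i => ?_, ?_⟩
      · have := hx.1 i
        have := hy.1 i
        simp only [PiLp.add_apply, PiLp.smul_apply, smul_eq_mul]
        positivity
      · have h1 := mul_le_mul_of_nonneg_left hx.2 ha
        have h2 := mul_le_mul_of_nonneg_left hy.2 hb
        simp only [PiLp.add_apply, PiLp.smul_apply, smul_eq_mul, Finset.sum_add_distrib,
          ← Finset.mul_sum]
        linarith
  · rintro x ⟨h0, h1⟩
    -- The index `none` stands for the vertex `0`, which absorbs the remaining weight `1 - ∑ x i`.
    have hx : x = ∑ o : Option (Fin k), (o.elim (1 - ∑ i, x i) (fun i => x i)) •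
        (o.elim 0 (EuclideanSpace.basisFun (Fin k) ℝ) : EuclideanSpace ℝ (Fin k)) := by
      rw [Fintype.sum_option]
      simpa using ((EuclideanSpace.basisFun (Fin k) ℝ).sum_repr x).symm
    rw [hx]
    refine (convex_convexHull ℝ _).sum_mem ?_ ?_ ?_
    · rintro (_ | i) -
      · exact sub_nonneg.2 h1
      · exact h0 i
    · simp [Fintype.sum_option]
    · rintro (_ | i) -
      · exact subset_convexHull ℝ _ (Set.mem_insert _ _)
      · exact subset_convexHull ℝ _ (Set.mem_insert_of_mem _ ⟨i, rfl⟩)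

/-- The simplex is a linear image of the standard corner simplex, of volume `1 / k!`, and the map
scales `k`-volume by the root of its Gram determinant. No independence is needed: both sides vanish
in the degenerate case. -/
theorem kVolume_convexHull_insert_zero {n k : ℕ} (v : Fin k → Euc n) :
    kVolume k (convexHull ℝ (insert 0 (Set.range v))) =
      Real.sqrt (Matrix.gram ℝ v).det / k.factorial := by
  let F : EuclideanSpace ℝ (Fin k) →ₗ[ℝ] Euc n :=
    (EuclideanSpace.basisFun (Fin k) ℝ).toBasis.constr ℝ v
  have hF : ∀ i, F (EuclideanSpace.basisFun (Fin k) ℝ i) = v i := fun i => by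
    have := (EuclideanSpace.basisFun (Fin k) ℝ).toBasis.constr_basis ℝ v i
    rwa [OrthonormalBasis.coe_toBasis] at this
  have himg : convexHull ℝ (insert 0 (Set.range v)) =
      F '' convexHull ℝ (insert 0 (Set.range (EuclideanSpace.basisFun (Fin k) ℝ))) := by
    rw [F.image_convexHull, Set.image_insert_eq, map_zero, ← Set.range_comp]
    congr 3
    exact (funext hF).symm
  have hdet : F.normDet = Real.sqrt (Matrix.gram ℝ v).det := by
    have h := F.normDet_sq_eq_det_gram (EuclideanSpace.basisFun (Fin k) ℝ)
    simp only [hF] at h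
    rw [← Real.sqrt_sq F.normDet_nonneg]
    exact congrArg Real.sqrt h
  have hvol := F.euclideanHausdorffMeasure_image_eq_normDet_mul_volume
    (convexHull ℝ (insert 0 (Set.range (EuclideanSpace.basisFun (Fin k) ℝ))))
  rw [finrank_euclideanSpace_fin] at hvol
  have hm : NullMeasurableSet {x : Fin k → ℝ | (∀ i, 0 ≤ x i) ∧ ∑ i, x i ≤ 1} := by
    apply MeasurableSet.nullMeasurableSet
    apply IsClosed.measurableSet
    simp only [Set.ofPred_and, Set.ofPred_forall]
    exact (isClosed_iInter fun i => isClosed_le (by fun_prop) (by fun_prop)).inter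
      (isClosed_le (by fun_prop) (by fun_prop))
  rw [kVolume, Measure.real, himg, hvol, convexHull_insert_zero_basisFun,
    (PiLp.volume_preserving_ofLp (Fin k)).measure_preimage hm,
    volume_cornerSimplex k zero_le_one, ENNReal.toReal_mul,
    ENNReal.toReal_ofReal F.normDet_nonneg, ENNReal.toReal_ofReal (by positivity), hdet]
  simp [div_eq_mul_inv]

theorem kVolume_convexHull_insert {n k : ℕ} {ι : Type*} [Fintype ι] [DecidableEq ι]
    (hk : Fintype.card ι = k) (p : Euc n) (q : ι → Euc n) :
    kVolume k (convexHull ℝ (insert p (Set.range q))) =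
      Real.sqrt (Matrix.gram ℝ fun i => q i - p).det / k.factorial := by
  let e : Fin k ≃ ι := (Fintype.equivFinOfCardEq hk).symm
  have htrans : convexHull ℝ (insert p (Set.range q)) =
      (fun x => p + x) '' convexHull ℝ (insert 0 (Set.range fun i => q (e i) - p)) := by
    have := (AffineMap.const ℝ (Euc n) p + AffineMap.id ℝ (Euc n)).image_convexHull
      (insert 0 (Set.range fun i => q (e i) - p))
    simp only [AffineMap.coe_add, AffineMap.coe_const, AffineMap.coe_id] at this
    rw [show (fun x => p + x) = Function.const (Euc n) p + id from rfl, this,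
      Set.image_insert_eq, ← Set.range_comp]
    congr 2
    · simp
    · rw [← e.surjective.range_comp q]
      congr 1
      ext1 i
      simp
  have hdet : (Matrix.gram ℝ fun i => q i - p).det =
      (Matrix.gram ℝ fun i => q (e i) - p).det :=
    (Matrix.det_submatrix_equiv_self e (Matrix.gram ℝ fun i => q i - p)).symm
  rw [hdet, ← kVolume_convexHull_insert_zero, htrans, kVolume, kVolume]
  exact congrArg ENNReal.toReal
    ((IsometryEquiv.addLeft p).isometry.euclideanHausdorffMeasure_image _)

/-! ### Gradients of barycentric coordinates and complementary minors. -/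

theorem Matrix.det_eq_of_pair {α R : Type*} [Fintype α] [DecidableEq α] [CommRing R]
    (A : Matrix α α R) {a c : α} (hac : a ≠ c) (h : ∀ x, x = a ∨ x = c) :
    A.det = A a a * A c c - A a c * A c a := by
  let e : Fin 2 ≃ α := Equiv.ofBijective ![a, c]
    ⟨by intro x y; fin_cases x <;> fin_cases y <;> simp [hac, hac.symm],
      fun x => (h x).elim (fun h => ⟨0, h.symm⟩) fun h => ⟨1, h.symm⟩⟩
  rw [← Matrix.det_submatrix_equiv_self e A, Matrix.det_fin_two]
  rfl

/-- The gradient of the barycentric coordinate of index `i`. -/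
noncomputable def AffineBasis.coordGrad {n : ℕ} {ι : Type*} (b : AffineBasis ι ℝ (Euc n))
    (i : ι) : Euc n :=
  (InnerProductSpace.toDual ℝ (Euc n)).symm (LinearMap.toContinuousLinearMap (b.coord i).linear)

namespace AffineBasis

variable {n : ℕ} {ι : Type*} (b : AffineBasis ι ℝ (Euc n))

theorem inner_coordGrad (i : ι) (y : Euc n) :
    inner ℝ (b.coordGrad i) y = (b.coord i).linear y := by
  rw [coordGrad, InnerProductSpace.toDual_symm_apply]
  rfl

theorem inner_coordGrad_sub [DecidableEq ι] (i j k : ι) :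
    inner ℝ (b.coordGrad i) (b j - b k) =
      (if i = j then 1 else 0) - (if i = k then 1 else 0) := by
  rw [inner_coordGrad, ← vsub_eq_sub, AffineMap.linearMap_vsub, b.coord_apply, b.coord_apply,
    vsub_eq_sub]

theorem sum_inner_coordGrad [Fintype ι] (y : Euc n) :
    ∑ i, inner ℝ (b.coordGrad i) y = 0 := by
  have h : ∀ i, inner ℝ (b.coordGrad i) y = b.coord i y - b.coord i 0 := fun i => by
    rw [inner_coordGrad]
    simpa using (b.coord i).linearMap_vsub y 0
  simp [h, b.sum_coord_apply_eq_one]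

/-- The derivative of the identity `∑ λ i(y) • b i = y` for barycentric coordinates; the previous
lemma differentiates `∑ λ i = 1`, and the next takes the adjoint. -/
theorem sum_inner_coordGrad_smul [Fintype ι] (y : Euc n) :
    ∑ i, inner ℝ (b.coordGrad i) y • b i = y := by
  have h : ∀ i, inner ℝ (b.coordGrad i) y = b.coord i y - b.coord i 0 := fun i => by
    rw [inner_coordGrad]
    simpa using (b.coord i).linearMap_vsub y 0
  simp [h, sub_smul, b.linear_combination_coord_eq_self]

theorem sum_inner_smul_coordGrad [Fintype ι] (y : Euc n) :
    ∑ i, inner ℝ (b i) y • b.coordGrad i = y := by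
  refine ext_inner_right ℝ fun z => ?_
  conv_rhs => rw [← b.sum_inner_coordGrad_smul z]
  simp only [sum_inner, inner_sum, inner_smul_left, inner_smul_right]
  refine Finset.sum_congr rfl fun i _ => ?_
  rw [real_inner_comm (b i) y]
  simp [mul_comm]

/-- The trace of the identity map, written as `∑ b i ⊗ g i`. -/
theorem sum_inner_coordGrad_self [Fintype ι] : ∑ i, inner ℝ (b.coordGrad i) (b i) = (n : ℝ) := by
  let e := EuclideanSpace.basisFun (Fin n) ℝ
  have h : ∀ i, inner ℝ (b.coordGrad i) (b i) =
      ∑ s, inner ℝ (inner ℝ (b.coordGrad i) (e s) • b i) (e s) := fun i => by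
    rw [← e.sum_inner_mul_inner]
    refine Finset.sum_congr rfl fun s _ => ?_
    rw [inner_smul_left, real_inner_comm (b i)]
    simp
  simp_rw [h]
  rw [Finset.sum_comm]
  simp_rw [← sum_inner, b.sum_inner_coordGrad_smul]
  simp

/-- The cotangent formula for the Dirichlet energy of the identity map. -/
theorem sum_inner_coordGrad_mul_norm_sq [Fintype ι] :
    ∑ i, ∑ j, -inner ℝ (b.coordGrad i) (b.coordGrad j) * ‖b i - b j‖ ^ 2 = 2 * (n : ℝ) := by
  -- After expanding `‖b i - b j‖²`, this kills both square terms; only the cross term survives, and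
  -- it is twice the trace above.
  have hg : ∑ j, b.coordGrad j = 0 :=
    ext_inner_right ℝ fun z => by rw [sum_inner, b.sum_inner_coordGrad, inner_zero_left]
  have h1 : ∑ i, ∑ j, inner ℝ (b.coordGrad i) (b.coordGrad j) * ‖b i‖ ^ 2 = 0 := by
    simp_rw [← Finset.sum_mul, ← inner_sum, hg]
    simp
  have h2 : ∑ i, ∑ j, inner ℝ (b.coordGrad i) (b.coordGrad j) * ‖b j‖ ^ 2 = 0 := by
    rw [Finset.sum_comm]
    simp_rw [← Finset.sum_mul, ← sum_inner, hg]
    simp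
  have h3 : ∑ i, ∑ j, inner ℝ (b.coordGrad i) (b.coordGrad j) * inner ℝ (b i) (b j) = (n : ℝ) := by
    rw [← b.sum_inner_coordGrad_self]
    refine Finset.sum_congr rfl fun i _ => ?_
    have h := congrArg (inner ℝ (b.coordGrad i)) (b.sum_inner_smul_coordGrad (b i))
    rw [← h, inner_sum]
    refine Finset.sum_congr rfl fun j _ => ?_
    rw [inner_smul_right, real_inner_comm (b i) (b j), mul_comm]
  have : ∀ i j, -inner ℝ (b.coordGrad i) (b.coordGrad j) * ‖b i - b j‖ ^ 2 =
      2 * (inner ℝ (b.coordGrad i) (b.coordGrad j) * inner ℝ (b i) (b j)) -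
      inner ℝ (b.coordGrad i) (b.coordGrad j) * ‖b i‖ ^ 2 -
      inner ℝ (b.coordGrad i) (b.coordGrad j) * ‖b j‖ ^ 2 := fun i j => by
    rw [norm_sub_sq_real]
    ring
  simp_rw [this, Finset.sum_sub_distrib, ← Finset.mul_sum, h1, h2, h3]
  ring

/-- The Gram determinant of two gradients of barycentric coordinates. -/
noncomputable def gradGram (i j : ι) : ℝ :=
  ‖b.coordGrad i‖ ^ 2 * ‖b.coordGrad j‖ ^ 2 - inner ℝ (b.coordGrad i) (b.coordGrad j) ^ 2

/-- Jacobi's complementary minor identity: the gradients other than that of `o` are dual to the edge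
vectors from `o`, so their Gram matrix is the inverse of `G`, and `gradGram` is a `2 × 2` minor of
this inverse. -/
theorem det_gram_mul_gradGram [Fintype ι] [DecidableEq ι] {i j o : ι} (hij : i ≠ j)
    (hi : i ≠ o) (hj : j ≠ o) :
    (Matrix.gram ℝ fun x : {x // x ≠ o} => b x - b o).det * b.gradGram i j =
      (Matrix.gram ℝ fun x : {x : {x // x ≠ o} // ¬ (x = ⟨i, hi⟩ ∨ x = ⟨j, hj⟩)} =>
        b x - b o).det := by
  classical
  set G := Matrix.gram ℝ fun x : {x // x ≠ o} => b x - b o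
  let p : {x // x ≠ o} → Prop := fun x => x = ⟨i, hi⟩ ∨ x = ⟨j, hj⟩
  -- The identity matrix with columns `i` and `j` replaced by those of the inverse of `G`. In `G *
  -- N` these two columns become unit vectors while the others stay those of `G`, so both
  -- determinants reduce to one block.
  let N : Matrix {x // x ≠ o} {x // x ≠ o} ℝ := Matrix.of fun x y =>
    if p y then inner ℝ (b.coordGrad x) (b.coordGrad y) else if x = y then 1 else 0
  have hdual : ∀ x y : {x // x ≠ o},
      ∑ z : {x // x ≠ o}, inner ℝ (b x - b o) (b z - b o) *
        inner ℝ (b.coordGrad z) (b.coordGrad y) = if x = y then 1 else 0 := fun x y => by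
    have h1 := b.sum_inner_smul_coordGrad (b x - b o)
    have h2 := congrArg (fun t => inner ℝ t (b.coordGrad y)) h1
    -- Replacing `b z` by `b z - b o` in the sum over all vertices is free because the gradients sum
    -- to zero; the term at `o` then drops out.
    have h0 : ∑ z, inner ℝ (b o) (b x - b o) * inner ℝ (b.coordGrad z) (b.coordGrad y) = 0 := by
      rw [← Finset.mul_sum, b.sum_inner_coordGrad, mul_zero]
    simp only [sum_inner, inner_smul_left] at h2
    have h3 : ∑ z, inner ℝ (b z - b o) (b x - b o) * inner ℝ (b.coordGrad z) (b.coordGrad y) =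
        inner ℝ (b x - b o) (b.coordGrad y) := by
      rw [← h2, ← sub_eq_zero, ← Finset.sum_sub_distrib, ← neg_eq_zero, ← h0,
        ← Finset.sum_neg_distrib]
      refine Finset.sum_congr rfl fun z _ => ?_
      simp only [inner_sub_left, conj_trivial]
      ring
    rw [real_inner_comm, b.inner_coordGrad_sub, if_neg (fun h => y.2 h), sub_zero] at h3
    rw [Fintype.sum_eq_add_sum_subtype_ne _ o, sub_self, inner_zero_left, zero_mul, zero_add] at h3
    simp_rw [real_inner_comm (b _ - b o) (b x - b o), Subtype.ext_iff, eq_comm (a := (x : ι))]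
    exact h3
  have hGN : G * N = Matrix.of fun x y =>
      if p y then (if x = y then 1 else 0) else G x y := by
    ext x y
    rw [Matrix.mul_apply, Matrix.of_apply]
    by_cases hy : p y
    · simp only [N, Matrix.of_apply, if_pos hy]
      exact hdual x y
    · simp [N, Matrix.of_apply, if_neg hy]
  have hN : N.det = b.gradGram i j := by
    rw [N.twoBlockTriangular_det' p fun x hx y hy => by
      simp only [N, Matrix.of_apply, if_neg hy]
      exact if_neg fun h : x = y => hy (h ▸ hx)]
    have h1 : N.toSquareBlockProp (fun x => ¬ p x) = 1 := by
      ext x y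
      simp [N, Matrix.toSquareBlockProp_def, if_neg y.2, Matrix.one_apply, Subtype.ext_iff]
    have hpij : (⟨⟨i, hi⟩, Or.inl rfl⟩ : {x // p x}) ≠ ⟨⟨j, hj⟩, Or.inr rfl⟩ := fun h =>
      hij (congrArg (fun x => (x.1 : ι)) h)
    rw [h1, Matrix.det_one, mul_one, Matrix.det_eq_of_pair _ hpij fun x => by
      rcases x with ⟨x, rfl | rfl⟩ <;> simp]
    simp [N, Matrix.toSquareBlockProp_def, p, gradGram, real_inner_comm (b.coordGrad j), sq]
  have hdet : (G * N).det = (G.toSquareBlockProp fun x => ¬ p x).det := by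
    rw [hGN, Matrix.twoBlockTriangular_det _ p fun x hx y hy => by
      rw [Matrix.of_apply, if_pos hy]
      exact if_neg fun h : x = y => hx (h ▸ hy)]
    have h1 : (Matrix.of fun x y => if p y then (if x = y then 1 else 0) else G x y).toSquareBlockProp
        p = 1 := by
      ext x y
      simp [Matrix.toSquareBlockProp_def, if_pos y.2, Matrix.one_apply, Subtype.ext_iff]
    rw [h1, Matrix.det_one, one_mul]
    congr 1
    ext x y
    simp [Matrix.toSquareBlockProp_def, if_neg y.2]
  rw [← hN, ← Matrix.det_mul, hdet]
  rfl

end AffineBasis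

/-! ### The cotangent formula for one simplex. -/

theorem cot_pi_sub_angle {E : Type*} [NormedAddCommGroup E] [InnerProductSpace ℝ E] {x y : E}
    (hx : x ≠ 0) (hy : y ≠ 0) :
    Real.cot (Real.pi - InnerProductGeometry.angle x y) =
      -inner ℝ x y / Real.sqrt (‖x‖ ^ 2 * ‖y‖ ^ 2 - inner ℝ x y ^ 2) := by
  have h := InnerProductGeometry.sin_angle_mul_norm_mul_norm x y
  rw [real_inner_self_eq_norm_sq, real_inner_self_eq_norm_sq, ← sq (inner ℝ x y)] at h
  have hxy : ‖x‖ * ‖y‖ ≠ 0 := mul_ne_zero (norm_ne_zero_iff.2 hx) (norm_ne_zero_iff.2 hy)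
  rw [Real.cot_eq_cos_div_sin, Real.cos_pi_sub, Real.sin_pi_sub, ← h,
    ← InnerProductGeometry.cos_angle_mul_norm_mul_norm, ← neg_mul, mul_div_mul_right _ _ hxy]

namespace AffineBasis

variable {n : ℕ} {ι : Type*} (b : AffineBasis ι ℝ (Euc n))

theorem coordGrad_ne_zero [Nontrivial ι] (i : ι) : b.coordGrad i ≠ 0 := by
  classical
  obtain ⟨j, hj⟩ := exists_ne i
  intro h
  have := b.inner_coordGrad_sub i i j
  simp [h, hj.symm] at this

theorem linearIndependent_sub (o : ι) :
    LinearIndependent ℝ fun x : {x // x ≠ o} => b x - b o :=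
  (affineIndependent_iff_linearIndependent_vsub ℝ b o).1 b.ind

theorem det_gram_sub_pos [Fintype ι] [DecidableEq ι] (o : ι) :
    0 < (Matrix.gram ℝ fun x : {x // x ≠ o} => b x - b o).det :=
  (Matrix.posDef_gram_of_linearIndependent (b.linearIndependent_sub o)).det_pos

theorem kVolume_convexHull [Fintype ι] [DecidableEq ι] (hι : Fintype.card ι = n + 1) (o : ι) :
    kVolume n (convexHull ℝ (Set.range b)) =
      Real.sqrt (Matrix.gram ℝ fun x : {x // x ≠ o} => b x - b o).det / n.factorial := by
  rw [← kVolume_convexHull_insert (by simp [Fintype.card_subtype_compl, hι]) (b o)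
    fun x : {x // x ≠ o} => b x]
  congr 2
  ext y
  constructor
  · rintro ⟨x, rfl⟩
    by_cases h : x = o
    · exact Or.inl (congrArg b h)
    · exact Or.inr ⟨⟨x, h⟩, rfl⟩
  · rintro (rfl | ⟨x, rfl⟩) <;> exact ⟨_, rfl⟩

theorem kVolume_convexHull_pos [Fintype ι] (hι : Fintype.card ι = n + 1) :
    0 < kVolume n (convexHull ℝ (Set.range b)) := by
  classical
  obtain ⟨o⟩ := b.nonempty
  rw [b.kVolume_convexHull hι o]
  have := Real.sqrt_pos.2 (b.det_gram_sub_pos o)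
  positivity

/-- Provides a base vertex lying on the face opposite to the edge `i j`, so that the simplex and
this face have edge vectors from a common origin. -/
theorem exists_ne_ne [Fintype ι] (hn : 2 ≤ n) (hι : Fintype.card ι = n + 1) (i j : ι) :
    ∃ o, i ≠ o ∧ j ≠ o := by
  classical
  obtain ⟨o, ho⟩ := Finset.exists_mem_notMem_of_card_lt_card
    (s := {i, j}) (t := Finset.univ)
    (Finset.card_le_two.trans_lt (by rw [Finset.card_univ, hι]; lia))
  simp only [Finset.mem_insert, Finset.mem_singleton, not_or] at ho
  exact ⟨o, Ne.symm ho.2.1, Ne.symm ho.2.2⟩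

theorem gradGram_pos [Fintype ι] (hn : 2 ≤ n) (hι : Fintype.card ι = n + 1) {i j : ι}
    (hij : i ≠ j) : 0 < b.gradGram i j := by
  classical
  obtain ⟨o, hi, hj⟩ := exists_ne_ne hn hι i j
  refine pos_of_mul_pos_right ?_ (b.det_gram_sub_pos o).le
  rw [b.det_gram_mul_gradGram hij hi hj]
  exact (Matrix.posDef_gram_of_linearIndependent
    ((b.linearIndependent_sub o).comp _ Subtype.val_injective)).det_pos

/-- The complementary minor identity after taking square roots; `n * (n - 1)` is `n! / (n - 2)!`. -/
theorem kVolume_convexHull_image_compl_pair [Fintype ι] (hn : 2 ≤ n)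
    (hι : Fintype.card ι = n + 1) {i j : ι} (hij : i ≠ j) :
    kVolume (n - 2) (convexHull ℝ (b '' {i, j}ᶜ)) =
      n * (n - 1) * kVolume n (convexHull ℝ (Set.range b)) * Real.sqrt (b.gradGram i j) := by
  classical
  obtain ⟨o, hi, hj⟩ := exists_ne_ne hn hι i j
  have hset : b '' {i, j}ᶜ = insert (b o)
      (Set.range fun x : {x : {x // x ≠ o} // ¬ (x = ⟨i, hi⟩ ∨ x = ⟨j, hj⟩)} => b x) := by
    ext y
    constructor
    · rintro ⟨x, hx, rfl⟩
      by_cases h : x = o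
      · exact Or.inl (congrArg b h)
      · exact Or.inr ⟨⟨⟨x, h⟩, by simpa [Subtype.ext_iff] using hx⟩, rfl⟩
    · rintro (rfl | ⟨x, rfl⟩)
      · exact ⟨o, by simp [hi.symm, hj.symm], rfl⟩
      · exact ⟨x, by simpa [Subtype.ext_iff] using x.2, rfl⟩
  have hcard : Fintype.card {x : {x // x ≠ o} // ¬ (x = ⟨i, hi⟩ ∨ x = ⟨j, hj⟩)} = n - 2 := by
    rw [Fintype.card_subtype_compl, Fintype.card_subtype_compl, hι, Fintype.card_subtype_eq,
      Fintype.card_subtype_eq_or_eq_of_ne (by simpa [Subtype.ext_iff] using hij)]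
    lia
  rw [hset, kVolume_convexHull_insert hcard, b.kVolume_convexHull hι o,
    ← b.det_gram_mul_gradGram hij hi hj, Real.sqrt_mul (b.det_gram_sub_pos o).le]
  obtain ⟨m, rfl⟩ := Nat.exists_eq_add_of_le' hn
  rw [Nat.add_sub_cancel, Nat.factorial_succ, Nat.factorial_succ]
  have : (m.factorial : ℝ) ≠ 0 := by positivity
  push_cast
  field_simp
  ring

/-- The gradient is normal to the facet and pairs to `1` with `b i - b j`, so the inward normal is a
positive multiple of it. Angles between normals are therefore angles between gradients. -/
theorem starProjection_orthogonal_vectorSpan [Fintype ι] {i j : ι} (hij : i ≠ j) :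
    (vectorSpan ℝ (b '' {i}ᶜ))ᗮ.starProjection (b i - b j) =
      (‖b.coordGrad i‖ ^ 2)⁻¹ • b.coordGrad i := by
  classical
  have : Nontrivial ι := ⟨i, j, hij⟩
  have hg : ‖b.coordGrad i‖ ^ 2 ≠ 0 := by simpa using b.coordGrad_ne_zero i
  apply Submodule.eq_starProjection_of_mem_orthogonal
  · refine Submodule.smul_mem _ _ ?_
    rw [Submodule.mem_orthogonal']
    intro u hu
    induction hu using Submodule.span_induction with
    | mem u hu =>
      obtain ⟨_, ⟨k, hk, rfl⟩, _, ⟨l, hl, rfl⟩, rfl⟩ := hu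
      simp only [vsub_eq_sub, b.inner_coordGrad_sub, if_neg (Ne.symm hk), if_neg (Ne.symm hl),
        sub_zero]
    | zero => simp
    | add x y _ _ hx hy => rw [inner_add_right, hx, hy, add_zero]
    | smul a x _ hx => rw [inner_smul_right, hx, mul_zero]
  · rw [Submodule.mem_orthogonal]
    intro z hz
    have hz' : ∀ k, k ≠ i → inner ℝ (b k) z = inner ℝ (b j) z := fun k hk => by
      have := (Submodule.mem_orthogonal _ _).1 hz (b k - b j)
        (vsub_mem_vectorSpan ℝ ⟨k, hk, rfl⟩ ⟨j, hij.symm, rfl⟩)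
      rwa [inner_sub_left, sub_eq_zero] at this
    have hg0 : ∑ k, b.coordGrad k = 0 :=
      ext_inner_right ℝ fun z => by rw [sum_inner, b.sum_inner_coordGrad, inner_zero_left]
    -- In the expansion of `z` along the gradients all coefficients with `k ≠ i` agree, and
    -- subtracting this common value changes nothing: the normal space is the line of `b.coordGrad
    -- i`.
    have hzg : z = inner ℝ (b i - b j) z • b.coordGrad i := by
      have h0 : ∑ k, inner ℝ (b j) z • b.coordGrad k = 0 := by
        rw [← Finset.smul_sum, hg0, smul_zero]
      have h1 := b.sum_inner_smul_coordGrad z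
      rw [inner_sub_left, sub_smul]
      calc z = ∑ k, (inner ℝ (b k) z • b.coordGrad k - inner ℝ (b j) z • b.coordGrad k) := by
            rw [Finset.sum_sub_distrib, h0, h1, sub_zero]
        _ = _ := Finset.sum_eq_single i (fun k _ hk => by rw [hz' k hk, sub_self]) (by simp)
    generalize hc : inner ℝ (b i - b j) z = c at hzg
    rw [inner_sub_right, real_inner_comm, hc, hzg, inner_smul_left, inner_smul_right,
      real_inner_self_eq_norm_sq, inv_mul_cancel₀ hg]
    simp

/-- The root of `gradGram` is the denominator of the cotangent and also a factor of the face volume,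
so it cancels. -/
theorem kVolume_mul_cot [Fintype ι] (hn : 2 ≤ n) (hι : Fintype.card ι = n + 1) {i j : ι}
    (hij : i ≠ j) :
    kVolume (n - 2) (convexHull ℝ (b '' {i, j}ᶜ)) *
      Real.cot (Real.pi - InnerProductGeometry.angle
        ((vectorSpan ℝ (b '' {i}ᶜ))ᗮ.starProjection (b i - b j))
        ((vectorSpan ℝ (b '' {j}ᶜ))ᗮ.starProjection (b j - b i))) =
      n * (n - 1) * kVolume n (convexHull ℝ (Set.range b)) *
        -inner ℝ (b.coordGrad i) (b.coordGrad j) := by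
  have : Nontrivial ι := ⟨i, j, hij⟩
  have hpos : ∀ k, 0 < (‖b.coordGrad k‖ ^ 2)⁻¹ := fun k => by
    have := norm_pos_iff.2 (b.coordGrad_ne_zero k)
    positivity
  rw [b.starProjection_orthogonal_vectorSpan hij, b.starProjection_orthogonal_vectorSpan hij.symm,
    InnerProductGeometry.angle_smul_left_of_pos _ _ (hpos i),
    InnerProductGeometry.angle_smul_right_of_pos _ _ (hpos j),
    cot_pi_sub_angle (b.coordGrad_ne_zero i) (b.coordGrad_ne_zero j),
    b.kVolume_convexHull_image_compl_pair hn hι hij, ← gradGram]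
  have := Real.sqrt_pos.2 (b.gradGram_pos hn hι hij)
  field_simp

end AffineBasis

/-! ### From the Laplacian trace to a sum over simplices. -/

theorem Matrix.trace_transpose_mul_laplacian_mul {n : ℕ} {V : Type*} [Fintype V] [DecidableEq V]
    {L : Matrix V V ℝ} {w : V → V → ℝ} (hw : ∀ i j, w i j = w j i)
    (hL : ∀ i j, L i j = if i = j then ∑ l ∈ Finset.univ.erase i, w i l else -w i j)
    (F : V → Euc n) :
    ((Matrix.of fun v s => F v s).transpose * L * (Matrix.of fun v s => F v s)).trace =
      1 / 2 * ∑ i, ∑ j, w i j * ‖F i - F j‖ ^ 2 := by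
  -- The value `w i i` is added and subtracted, so it is irrelevant; it carries no geometric meaning
  -- for the cotangent weights.
  have hL' : ∀ i j, L i j = (if i = j then ∑ l, w i l else 0) - w i j := fun i j => by
    rw [hL]
    split_ifs with h
    · rw [← Finset.add_sum_erase _ _ (Finset.mem_univ i), ← h]
      ring
    · ring
  have h1 : ((Matrix.of fun v s => F v s).transpose * L * (Matrix.of fun v s => F v s)).trace =
      ∑ i, ∑ j, L i j * inner ℝ (F i) (F j) := by
    simp only [Matrix.trace, Matrix.diag, Matrix.mul_apply, Matrix.transpose_apply,
      Matrix.of_apply, PiLp.inner_apply, Finset.sum_mul, Finset.mul_sum]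
    rw [Finset.sum_comm]
    simp_rw [Finset.sum_comm (s := (Finset.univ : Finset (Fin n)))]
    rw [Finset.sum_comm]
    refine Finset.sum_congr rfl fun i _ => Finset.sum_congr rfl fun j _ =>
      Finset.sum_congr rfl fun s _ => ?_
    simp only [RCLike.inner_apply, conj_trivial]
    ring
  have h2 : ∑ i, ∑ j, w i j * ‖F j‖ ^ 2 = ∑ i, ∑ j, w i j * ‖F i‖ ^ 2 := by
    rw [Finset.sum_comm]
    simp_rw [hw]
  have h3 : ∀ i j, w i j * ‖F i - F j‖ ^ 2 =
      w i j * ‖F i‖ ^ 2 - 2 * (w i j * inner ℝ (F i) (F j)) + w i j * ‖F j‖ ^ 2 := fun i j => by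
    rw [norm_sub_sq_real]
    ring
  simp_rw [h1, hL', h3, Finset.sum_add_distrib, Finset.sum_sub_distrib, h2, sub_mul,
    Finset.sum_sub_distrib, ite_mul, zero_mul, Finset.sum_ite_eq, Finset.mem_univ, if_true,
    real_inner_self_eq_norm_sq, ← Finset.mul_sum, Finset.sum_mul]
  ring

theorem Finset.sum_sum_sum_ite_mem {α R : Type*} [DecidableEq α] [AddCommMonoid R]
    {V : Finset α} {S : Finset (Finset α)} (hS : ∀ σ ∈ S, σ ⊆ V) (t : Finset α → α → α → R) :
    ∑ v : V, ∑ w : V, ∑ σ ∈ S,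
      (if (v : α) ∈ σ then if (w : α) ∈ σ then t σ v w else 0 else 0) =
      ∑ σ ∈ S, ∑ v ∈ σ, ∑ w ∈ σ, t σ v w := by
  simp_rw [Finset.sum_comm (t := S)]
  refine Finset.sum_congr rfl fun σ hσ => ?_
  have hsub : V ∩ σ = σ := Finset.inter_eq_right.2 (hS σ hσ)
  have h : ∀ g : α → R, ∑ w : V, (if (w : α) ∈ σ then g w else 0) = ∑ w ∈ σ, g w := fun g => by
    rw [Finset.sum_coe_sort V fun w => if w ∈ σ then g w else 0, Finset.sum_ite_mem, hsub]
  rw [← h]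
  refine Finset.sum_congr rfl fun v _ => ?_
  split_ifs
  · exact h _
  · simp

namespace DiscreteManifold

variable {n : ℕ} {M : DiscreteManifold n} {f : Euc n → Euc n}

theorem mem_simplices {k : ℕ} {σ : Finset (Euc n)} :
    σ ∈ M.simplices k ↔ σ ∈ M.complex.faces ∧ σ.card = k + 1 := by
  simp [simplices]

theorem mem_vertices_of_mem_simplices {k : ℕ} {σ : Finset (Euc n)} (hσ : σ ∈ M.simplices k)
    {v : Euc n} (hv : v ∈ σ) : v ∈ M.vertices := by
  rw [vertices, Finset.mem_biUnion]
  exact ⟨σ, M.finite_faces.mem_toFinset.2 (mem_simplices.1 hσ).1, hv⟩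

/-- A nonzero Jacobian makes the affine piece injective, so the `n + 1` image vertices stay affinely
independent and the results on affine bases apply to `f(σ)`. -/
theorem exists_affineBasis (hf : M.OrientationPreserving f) {σ : Finset (Euc n)}
    (hσ : σ ∈ M.simplices n) :
    ∃ b : AffineBasis σ ℝ (Euc n), (∀ x : σ, b x = f x) ∧ f '' σ = Set.range b ∧
      ∀ τ ⊆ σ, f '' convexHull ℝ (τ : Set (Euc n)) = convexHull ℝ (f '' τ) := by
  obtain ⟨A, hA, hdet⟩ := hf σ hσ
  obtain ⟨hface, hcard⟩ := mem_simplices.1 hσ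
  have hinj : Function.Injective A := by
    rw [← A.linear_injective_iff]
    refine LinearMap.ker_eq_bot.1 ?_
    by_contra h
    exact hdet.ne' (LinearMap.det_eq_zero_iff_ker_ne_bot.2 h)
  have hind := (M.complex.indep hface).map' A hinj
  refine ⟨⟨A ∘ ((↑) : σ → Euc n), hind, ?_⟩, fun x => ?_, ?_, fun τ hτ => ?_⟩
  · rw [hind.affineSpan_eq_top_iff_card_eq_finrank_add_one]
    simp [hcard]
  · exact (hA (subset_convexHull ℝ _ x.2)).symm
  · rw [(hA.mono (subset_convexHull ℝ _)).image_eq]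
    exact (Set.range_comp A ((↑) : σ → Euc n)).trans (by rw [Subtype.range_coe]) |>.symm
  · have hτ' : (τ : Set (Euc n)) ⊆ convexHull ℝ (σ : Set (Euc n)) :=
      (Finset.coe_subset.2 hτ).trans (subset_convexHull ℝ _)
    rw [(hA.mono (convexHull_mono (Finset.coe_subset.2 hτ))).image_eq, (hA.mono hτ').image_eq,
      A.image_convexHull]

theorem imageVolume_pos (hf : M.OrientationPreserving f) {σ : Finset (Euc n)}
    (hσ : σ ∈ M.simplices n) : 0 < imageVolume n f σ := by
  obtain ⟨b, -, hrange, himg⟩ := exists_affineBasis hf hσ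
  have h := b.kVolume_convexHull_pos (by simpa using (mem_simplices.1 hσ).2)
  rwa [imageVolume, himg σ subset_rfl, hrange]

/-- Transfers positivity of image volumes to the simplices of `M` themselves. -/
theorem orientationPreserving_id : M.OrientationPreserving id :=
  fun _ _ => ⟨AffineMap.id ℝ _, fun _ _ => rfl, by simp⟩

theorem mass_pos {ρ : Finset (Euc n) → ℝ} {σ : Finset (Euc n)} (hσ : σ ∈ M.simplices n)
    (hρ : 0 < ρ σ) : 0 < mass ρ σ := by
  have h := imageVolume_pos orientationPreserving_id hσ
  rw [imageVolume, Set.image_id] at h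
  exact mul_pos hρ h

open Classical in
theorem sum_imageVolume_mul_cot (hn : 2 ≤ n) (hf : M.OrientationPreserving f)
    {σ : Finset (Euc n)} (hσ : σ ∈ M.simplices n) :
    ∑ v ∈ σ, ∑ w ∈ σ, imageVolume (n - 2) f (σ \ {v, w}) * Real.cot (dihedralAngle f σ v w) *
      ‖f v - f w‖ ^ 2 = 2 * n ^ 2 * (n - 1) * imageVolume n f σ := by
  obtain ⟨b, hb, hrange, himg⟩ := exists_affineBasis hf hσ
  have hcard : Fintype.card σ = n + 1 := by simpa using (mem_simplices.1 hσ).2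
  have hvol : imageVolume n f σ = kVolume n (convexHull ℝ (Set.range b)) := by
    rw [imageVolume, himg σ subset_rfl, hrange]
  have hfacet : ∀ i : σ, f '' ((σ : Set (Euc n)) \ {(i : Euc n)}) = b '' {i}ᶜ := fun i => by
    ext y
    constructor
    · rintro ⟨x, ⟨hx, hxi⟩, rfl⟩
      exact ⟨⟨x, hx⟩, fun h => hxi (congrArg Subtype.val h), hb _⟩
    · rintro ⟨x, hx, rfl⟩
      exact ⟨x, ⟨x.2, fun h => hx (Subtype.ext h)⟩, (hb x).symm⟩
  have hface : ∀ i j : σ, f '' ((σ \ {(i : Euc n), (j : Euc n)} : Finset (Euc n)) : Set (Euc n)) =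
      b '' {i, j}ᶜ := fun i j => by
    rw [Finset.coe_sdiff, Finset.coe_pair]
    ext y
    constructor
    · rintro ⟨x, ⟨hx, hxi⟩, rfl⟩
      exact ⟨⟨x, hx⟩, fun h => hxi (h.imp (congrArg Subtype.val) (congrArg Subtype.val)), hb _⟩
    · rintro ⟨x, hx, rfl⟩
      exact ⟨x, ⟨x.2, fun h => hx (h.imp Subtype.ext Subtype.ext)⟩, (hb x).symm⟩
  have hnormal : ∀ i j : σ, inwardNormal f σ i j =
      (vectorSpan ℝ (b '' {i}ᶜ))ᗮ.starProjection (b i - b j) := fun i j => by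
    simp only [inwardNormal, hfacet, hb]
  have hterm : ∀ i j : σ, imageVolume (n - 2) f (σ \ {(i : Euc n), (j : Euc n)}) *
      Real.cot (dihedralAngle f σ i j) * ‖f i - f j‖ ^ 2 =
      n * (n - 1) * imageVolume n f σ *
        (-inner ℝ (b.coordGrad i) (b.coordGrad j) * ‖b i - b j‖ ^ 2) := fun i j => by
    -- On the diagonal the dihedral angle is meaningless, but the factor `‖f i - f j‖ ^ 2` vanishes.
    by_cases hij : i = j
    · simp [hij]
    · rw [imageVolume, himg _ Finset.sdiff_subset, hface, dihedralAngle, hnormal,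
        hnormal, ← hb, ← hb, b.kVolume_mul_cot hn hcard hij, hvol]
      ring
  rw [← Finset.sum_coe_sort]
  simp_rw [← Finset.sum_coe_sort σ, hterm, ← Finset.mul_sum, b.sum_inner_coordGrad_mul_norm_sq]
  ring

theorem weight_comm (ρ : Finset (Euc n) → ℝ) (v w : Euc n) :
    M.weight ρ f v w = M.weight ρ f w v := by
  classical
  simp only [weight, dihedralAngle, Finset.pair_comm v w, and_comm (a := v ∈ _),
    InnerProductGeometry.angle_comm (inwardNormal f _ v w)]

/-- A pair that is not an edge lies in no simplex, so the zero entries of the Laplacian also have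
the form `-w i j`. -/
theorem weight_eq_zero (ρ : Finset (Euc n) → ℝ) {v w : Euc n} (hvw : v ≠ w)
    (h : ({v, w} : Finset (Euc n)) ∉ M.simplices 1) : M.weight ρ f v w = 0 := by
  classical
  rw [weight, Finset.filter_false_of_mem, Finset.sum_empty, mul_zero]
  rintro σ hσ ⟨hv, hw⟩
  refine h (mem_simplices.2 ⟨M.complex.down_closed (mem_simplices.1 hσ).1 ?_ (by simp), ?_⟩)
  · simp [Finset.insert_subset_iff, hv, hw]
  · convert Finset.card_pair hvw

theorem stretchEnergy_eq_sum (hn : 2 ≤ n) (ρ : Finset (Euc n) → ℝ)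
    (hf : M.OrientationPreserving f) :
    M.stretchEnergy ρ f = ∑ σ ∈ M.simplices n, imageVolume n f σ ^ 2 / mass ρ σ := by
  classical
  have htrace := Matrix.trace_transpose_mul_laplacian_mul (L := M.stretchLaplacian ρ f)
    (w := fun i j : M.vertices => M.weight ρ f i j) (fun i j => weight_comm ρ _ _)
    (fun i j => by
      rw [stretchLaplacian, Matrix.of_apply]
      by_cases hij : i = j
      · rw [if_pos hij, if_pos hij]
      · rw [if_neg hij, if_neg hij]
        split_ifs with h
        · rfl
        · rw [weight_eq_zero ρ (Subtype.coe_injective.ne hij) h, neg_zero])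
    fun v => f v
  have hn' : (2 : ℝ) ≤ n := by exact_mod_cast hn
  have hsum : ∑ i : M.vertices, ∑ j : M.vertices, M.weight ρ f i j * ‖f i - f j‖ ^ 2 =
      ∑ σ ∈ M.simplices n, 1 / ((n : ℝ) * (n - 1)) * (1 / stretchFactor ρ f σ) *
        ∑ v ∈ σ, ∑ w ∈ σ, imageVolume (n - 2) f (σ \ {v, w}) *
          Real.cot (dihedralAngle f σ v w) * ‖f v - f w‖ ^ 2 := by
    have hw : ∀ v w, M.weight ρ f v w * ‖f v - f w‖ ^ 2 = ∑ σ ∈ M.simplices n,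
        if v ∈ σ then if w ∈ σ then 1 / ((n : ℝ) * (n - 1)) * (1 / stretchFactor ρ f σ) *
          (imageVolume (n - 2) f (σ \ {v, w}) *
          Real.cot (dihedralAngle f σ v w) * ‖f v - f w‖ ^ 2) else 0 else 0 := fun v w => by
      rw [weight, Finset.mul_sum, Finset.sum_mul, Finset.sum_filter]
      refine Finset.sum_congr rfl fun σ _ => ?_
      rw [ite_and]
      congr! 2
      ring
    simp_rw [hw]
    refine (Finset.sum_sum_sum_ite_mem (fun σ hσ v hv => mem_vertices_of_mem_simplices hσ hv)
      fun σ v w => 1 / ((n : ℝ) * (n - 1)) * (1 / stretchFactor ρ f σ) *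
        (imageVolume (n - 2) f (σ \ {v, w}) *
          Real.cot (dihedralAngle f σ v w) * ‖f v - f w‖ ^ 2)).trans ?_
    simp_rw [Finset.mul_sum]
  rw [stretchEnergy, coordMatrix, htrace, hsum, Finset.mul_sum, Finset.mul_sum]
  refine Finset.sum_congr rfl fun σ hσ => ?_
  -- The constants `1 / n`, `1 / 2`, `1 / (n (n - 1))` and `2 n² (n - 1)` multiply to `1`; the
  -- inverse stretch factor supplies the second `|f(σ)|`.
  rw [sum_imageVolume_mul_cot hn hf hσ, stretchFactor, one_div_div]
  have : (n : ℝ) - 1 ≠ 0 := by linarith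
  have : (n : ℝ) ≠ 0 := by linarith
  field_simp

end DiscreteManifold

/-! ### Cauchy–Schwarz and the equality case. -/

/-- The deficit in Cauchy–Schwarz as a weighted variance of the ratios `a i / m i` about their mean.
Nonnegativity gives the bound, and vanishing characterises equality. -/
theorem Finset.sum_sq_sub_div {ι : Type*} (s : Finset ι) {a m : ι → ℝ} (hm : ∀ i ∈ s, 0 < m i) :
    ∑ i ∈ s, (a i - (∑ j ∈ s, a j) / (∑ j ∈ s, m j) * m i) ^ 2 / m i =
      ∑ i ∈ s, a i ^ 2 / m i - (∑ i ∈ s, a i) ^ 2 / ∑ i ∈ s, m i := by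
  rcases s.eq_empty_or_nonempty with rfl | hs
  · simp
  have hM := Finset.sum_pos hm hs
  generalize ht : (∑ j ∈ s, a j) / (∑ j ∈ s, m j) = t
  have h : ∀ i ∈ s, (a i - t * m i) ^ 2 / m i = a i ^ 2 / m i - 2 * t * a i + t ^ 2 * m i :=
    fun i hi => by
      have := (hm i hi).ne'
      field_simp
      ring
  rw [Finset.sum_congr rfl h, Finset.sum_add_distrib, Finset.sum_sub_distrib, ← Finset.mul_sum,
    ← Finset.mul_sum, ← ht]
  field_simp
  ring

namespace DiscreteManifold

variable {n : ℕ} {M : DiscreteManifold n} {f : Euc n → Euc n}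

/-- The deficit vanishes exactly when each of its squares does, and each such equation rearranges to
the equality of shares. -/
theorem massPreserving_iff {ρ : Finset (Euc n) → ℝ} (hρ : ∀ σ ∈ M.simplices n, 0 < ρ σ)
    (hf : M.OrientationPreserving f) :
    M.MassPreserving ρ f ↔
      ∑ σ ∈ M.simplices n, imageVolume n f σ ^ 2 / mass ρ σ =
        (∑ σ ∈ M.simplices n, imageVolume n f σ) ^ 2 / ∑ σ ∈ M.simplices n, mass ρ σ := by
  have hm : ∀ σ ∈ M.simplices n, 0 < mass ρ σ := fun σ hσ => mass_pos hσ (hρ σ hσ)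
  rw [← sub_eq_zero, ← Finset.sum_sq_sub_div _ hm, Finset.sum_eq_zero_iff_of_nonneg fun σ hσ => by
    have := hm σ hσ
    positivity]
  refine forall₂_congr fun σ hσ => ?_
  have h1 := Finset.sum_pos hm ⟨σ, hσ⟩
  have h2 := Finset.sum_pos (fun τ hτ => imageVolume_pos hf (M := M) hτ) ⟨σ, hσ⟩
  have h3 := hm σ hσ
  rw [div_eq_zero_iff, or_iff_left h3.ne', sq_eq_zero_iff, sub_eq_zero, div_eq_div_iff h2.ne' h1.ne',
    div_mul_eq_mul_div, eq_div_iff h1.ne', mul_comm (mass ρ σ)]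

theorem le_stretchEnergy (hn : 2 ≤ n) {ρ : Finset (Euc n) → ℝ}
    (hρ : ∀ σ ∈ M.simplices n, 0 < ρ σ) (hf : M.OrientationPreserving f) :
    (∑ σ ∈ M.simplices n, imageVolume n f σ) ^ 2 / ∑ σ ∈ M.simplices n, mass ρ σ ≤
      M.stretchEnergy ρ f := by
  have hm : ∀ σ ∈ M.simplices n, 0 < mass ρ σ := fun σ hσ => mass_pos hσ (hρ σ hσ)
  rw [stretchEnergy_eq_sum hn ρ hf, ← sub_nonneg, ← Finset.sum_sq_sub_div _ hm]
  exact Finset.sum_nonneg fun σ hσ => by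
    have := hm σ hσ
    positivity

end DiscreteManifold

theorem mainTheorem2 (n : ℕ) (hn : 2 ≤ n) (M : DiscreteManifold n)
    (ρ : Finset (Euc n) → ℝ) (hρ : ∀ σ ∈ M.simplices n, 0 < ρ σ) (C : ℝ) :
    (∀ e ∈ M.energySet ρ C, C ^ 2 / ∑ σ ∈ M.simplices n, DiscreteManifold.mass ρ σ ≤ e) ∧
    ∀ f : Euc n → Euc n, M.Admissible C f →
      (M.stretchEnergy ρ f = C ^ 2 / ∑ σ ∈ M.simplices n, DiscreteManifold.mass ρ σ ↔
        M.MassPreserving ρ f) ∧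
      ((IsLeast (M.energySet ρ C) (M.stretchEnergy ρ f) ∧
          M.stretchEnergy ρ f = C ^ 2 / ∑ σ ∈ M.simplices n, DiscreteManifold.mass ρ σ) ↔
        M.MassPreserving ρ f) := by
  have hle : ∀ e ∈ M.energySet ρ C, C ^ 2 / ∑ σ ∈ M.simplices n, DiscreteManifold.mass ρ σ ≤ e := by
    rintro _ ⟨f, hf, rfl⟩
    rw [← hf.volume_eq]
    exact DiscreteManifold.le_stretchEnergy hn hρ hf.orientationPreserving
  refine ⟨hle, fun f hf => ?_⟩
  have hiff : M.stretchEnergy ρ f = C ^ 2 / ∑ σ ∈ M.simplices n, DiscreteManifold.mass ρ σ ↔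
      M.MassPreserving ρ f := by
    rw [DiscreteManifold.massPreserving_iff hρ hf.orientationPreserving, ← hf.volume_eq,
      DiscreteManifold.stretchEnergy_eq_sum hn ρ hf.orientationPreserving]
  refine ⟨hiff, fun h => hiff.1 h.2, fun h => ⟨⟨⟨f, hf, rfl⟩, fun e he => ?_⟩, hiff.2 h⟩⟩
  rw [hiff.2 h]
  exact hle e he
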